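/- Let $\mathcal{A}$ be a complex Banach algebra with identity. For a ring $R$ with identity, call $a\in R$ quasinilpotent if $1+ax$ is invertible for every $x\in R$ with $xa=ax$, and call $a$ g-Drazin invertible if there is $b\in R$ such that $ab=ba$, $b=bab$ and $a-a^2b$ is quasinilpotent. For $R=\mathcal{A}$ and $R=M_2(\mathcal{A})$ such a $b$ is unique if it exists; it is denoted $a^d$, and we put $a^\pi=1-aa^d$. Let $A,B,C,D\in\mathcal{A}$, where $A$ and $D$ are g-Drazin invertible, let $\lambda$ be a nonzero complex number, and put $$M=\begin{pmatrix}A&B\\C&D\end{pmatrix},\quad P=\begin{pmatrix}A&0\\0&D\end{pmatrix},\quad Q=\begin{pmatrix}0&B\\C&0\end{pmatrix}\in M_2(\mathcal{A}).$$ If $AB=\lambda A^\pi BD$, $DC=0$ and $BC=0$, then $P$ and $M$ are g-Drazin invertible in $M_2(\mathcal{A})$, and $$M^d=\begin{pmatrix}A^d&0\\0&D^d\end{pmatrix}+\sum_{n=0}^\infty M^nQ(P^d)^{n+2},$$ where the series converges unconditionally in $M_2(\mathcal{A})$ (with the topology of entrywise norm convergence). -/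

import Mathlib

namespace GDrazin

/-- `a` is quasinilpotent: `1 + a x` is invertible for every `x` in the commutant of `a`. -/
def IsQuasinilpotent {R : Type*} [Ring R] (a : R) : Prop :=
  ∀ x : R, x * a = a * x → IsUnit (1 + a * x)

/-- `b` is a generalized Drazin inverse of `a`: `b` commutes with `a`, `b = b a b`, and
`a - a² b` is quasinilpotent. -/
structure IsGDrazinInverse {R : Type*} [Ring R] (a b : R) : Prop where
  comm : b * a = a * b
  eq_mul : b = b * a * b
  quasinilpotent : IsQuasinilpotent (a - a ^ 2 * b)

/-- `a` has a generalized Drazin inverse. -/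
def IsGDrazinInvertible {R : Type*} [Ring R] (a : R) : Prop :=
  ∃ b : R, IsGDrazinInverse a b

open Classical in
/-- The generalized Drazin inverse of `a` (with value `0` if `a` has none). In a complex Banach
algebra an element has at most one generalized Drazin inverse. -/
noncomputable def gDrazinInv {R : Type*} [Ring R] (a : R) : R :=
  if h : IsGDrazinInvertible a then h.choose else 0

theorem isGDrazinInverse_gDrazinInv {R : Type*} [Ring R] {a : R} (h : IsGDrazinInvertible a) :
    IsGDrazinInverse a (gDrazinInv a) := by
  unfold gDrazinInv
  rw [dif_pos h]
  exact h.choose_spec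

/-- The spectral idempotent `1 - a aᵈ` of `a`. -/
noncomputable def spectralIdempotent {R : Type*} [Ring R] (a : R) : R :=
  1 - a * gDrazinInv a

end GDrazin

namespace GDrazin

/-! ### Quasinilpotent elements: growth of powers and perturbation. -/

section Banach

variable {R : Type*} [NormedRing R] [NormedAlgebra ℂ R] [CompleteSpace R]

/-! Write `M = P + Q` and `d` for the inverse of `P`. The hypotheses force `d * Q = 0`, so `d` sees
only `P`: `d * M ^ n = P ^ n * d`. Hence `M ^ n * Q = N ^ n * Q` for `N = M * (1 - P * d)`, and the
series converges as soon as `N` is quasinilpotent. With sum `s`, the recursion `s = Q * d ^ 2 + M *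
s * d` makes `d + s` commute with `M`, and the remainder is `N` plus a square-zero term
(`IsGDrazinInverse.add_tsum`). `N` is quasinilpotent because it arises from `P * (1 - P * d)` by
adding the two off-diagonal halves of `Q`, cut down by `1 - P * d`. Each squares to zero and
suitably commutes or annihilates (`IsGDrazinInverse.isQuasinilpotent_add_add_mul`). Uniqueness then
identifies `gDrazinInv`. -/

theorem IsQuasinilpotent.isUnit_one_sub_smul {R : Type*} [Ring R] [Algebra ℂ R] {a : R}
    (ha : IsQuasinilpotent a) (z : ℂ) : IsUnit (1 - z • a) := by
  have h := ha ((-z) • 1) (by simp)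
  simpa [sub_eq_add_neg] using h

theorem summable_norm_pow_mul_of_isUnit {a : R} (ha : ∀ z : ℂ, IsUnit (1 - z • a)) (r : ℝ) :
    Summable fun n : ℕ => ‖a ^ n‖ * r ^ n := by
  have hrad : spectralRadius ℂ a = 0 := by
    refine le_antisymm (iSup₂_le fun k hk => ?_) bot_le
    by_cases hk0 : k = 0
    · simp [hk0]
    · refine absurd ?_ hk
      rw [spectrum.mem_resolventSet_iff]
      have h : algebraMap ℂ R k - a = k • (1 - k⁻¹ • a) := by
        rw [smul_sub, smul_smul, mul_inv_cancel₀ hk0, one_smul, Algebra.algebraMap_eq_smul_one]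
      rw [h]
      exact (ha k⁻¹).smul (Units.mk0 k hk0)
  have ht := spectrum.pow_nnnorm_pow_one_div_tendsto_nhds_spectralRadius a
  rw [hrad] at ht
  -- Chosen so that `ε * |r| ≤ 1 / 2`; the `+ 1` covers `r = 0`.
  set ε : ℝ := (2 * (|r| + 1))⁻¹ with hε
  have hε0 : 0 < ε := by positivity
  have hev : ∀ᶠ n : ℕ in Filter.atTop, ‖a ^ n‖ ≤ ε ^ n := by
    filter_upwards [ht.eventually_lt_const (ENNReal.ofReal_pos.2 hε0),
      Filter.eventually_gt_atTop 0] with n hn hn0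
    have h1 : (‖a ^ n‖₊ : ENNReal) ≤ ENNReal.ofReal ε ^ (n : ℝ) :=
      (ENNReal.rpow_inv_le_iff (by exact_mod_cast hn0)).1 (by simpa using hn.le)
    rw [ENNReal.rpow_natCast, ← ENNReal.ofReal_pow hε0.le, ← enorm_eq_nnnorm, ← ofReal_norm] at h1
    exact (ENNReal.ofReal_le_ofReal_iff (by positivity)).1 h1
  refine Summable.of_norm_bounded_eventually_nat (g := fun n : ℕ => (1 / 2 : ℝ) ^ n)
    (summable_geometric_of_lt_one (by norm_num) (by norm_num)) ?_
  filter_upwards [hev] with n hn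
  rw [norm_mul, norm_norm, norm_pow r, Real.norm_eq_abs]
  calc ‖a ^ n‖ * |r| ^ n ≤ ε ^ n * |r| ^ n := by gcongr
    _ = (ε * |r|) ^ n := (mul_pow _ _ _).symm
    _ ≤ (1 / 2) ^ n := by
      gcongr
      rw [hε, inv_mul_le_iff₀ (by positivity)]
      linarith

theorem isQuasinilpotent_of_isUnit_one_sub_smul {a : R} (ha : ∀ z : ℂ, IsUnit (1 - z • a)) :
    IsQuasinilpotent a := by
  intro x hx
  have hs : Summable fun n : ℕ => (-(a * x)) ^ n := by
    refine Summable.of_norm_bounded_eventually_nat (summable_norm_pow_mul_of_isUnit ha ‖x‖) ?_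
    -- `‖1‖ ≤ 1` is not assumed, so `n = 0` is left out.
    filter_upwards [Filter.eventually_gt_atTop 0] with n hn
    rw [← mul_neg, (show Commute a (-x) from (show Commute x a from hx).symm.neg_right).mul_pow]
    refine (norm_mul_le _ _).trans ?_
    gcongr
    simpa using norm_pow_le' (-x) hn
  have h1 := hs.tsum_pow_mul_one_sub
  have h2 := hs.one_sub_mul_tsum_pow
  rw [sub_neg_eq_add] at h1 h2
  exact ⟨⟨_, _, h2, h1⟩, rfl⟩

theorem isQuasinilpotent_iff_isUnit_one_sub_smul {a : R} :
    IsQuasinilpotent a ↔ ∀ z : ℂ, IsUnit (1 - z • a) :=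
  ⟨fun h z => h.isUnit_one_sub_smul z, isQuasinilpotent_of_isUnit_one_sub_smul⟩

theorem IsQuasinilpotent.summable_norm_pow_mul {a : R} (ha : IsQuasinilpotent a) (r : ℝ) :
    Summable fun n : ℕ => ‖a ^ n‖ * r ^ n :=
  summable_norm_pow_mul_of_isUnit ha.isUnit_one_sub_smul r

theorem IsQuasinilpotent.add_of_mul_eq_zero {a w : R} (ha : IsQuasinilpotent a)
    (hw : w * w = 0) (haw : a * w = 0) : IsQuasinilpotent (a + w) := by
  rw [isQuasinilpotent_iff_isUnit_one_sub_smul] at ha ⊢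
  intro z
  have h : 1 - z • (a + w) = (1 - z • a) * (1 - z • w) := by
    simp [mul_sub, sub_mul, haw]; abel
  rw [h]
  exact (ha z).mul (IsNilpotent.isUnit_one_sub ⟨2, by simp [pow_two, hw]⟩)

theorem IsQuasinilpotent.add_of_mul_eq_zero' {a w : R} (ha : IsQuasinilpotent a)
    (hw : w * w = 0) (hwa : w * a = 0) : IsQuasinilpotent (a + w) := by
  rw [isQuasinilpotent_iff_isUnit_one_sub_smul] at ha ⊢
  intro z
  have h : 1 - z • (a + w) = (1 - z • w) * (1 - z • a) := by
    simp [mul_sub, sub_mul, hwa]; abel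
  rw [h]
  exact (IsNilpotent.isUnit_one_sub ⟨2, by simp [pow_two, hw]⟩ : IsUnit (1 - z • w)).mul (ha z)

/-- Moving `b` leftwards past `u = 1 - z • p` turns `u` into the unit `v = 1 - (z * c) • p`, so `u⁻¹
* b = b * v⁻¹` still squares to zero, and `u` can be factored out. -/
theorem IsQuasinilpotent.add_of_mul_eq_smul {p b : R} {c : ℂ} (hp : IsQuasinilpotent p)
    (hb : b * b = 0) (hpb : p * b = c • (b * p)) : IsQuasinilpotent (p + b) := by
  rw [isQuasinilpotent_iff_isUnit_one_sub_smul] at hp ⊢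
  intro z
  obtain ⟨u, hu⟩ := hp z
  obtain ⟨v, hv⟩ := hp (z * c)
  have hcomm : (u : R) * b = b * v := by
    simp [hu, hv, sub_mul, mul_sub, hpb, smul_smul]
  have hinv : (↑u⁻¹ : R) * b = b * ↑v⁻¹ := by
    rw [Units.inv_mul_eq_iff_eq_mul, ← mul_assoc, hcomm, mul_assoc, Units.mul_inv, mul_one]
  have hsq : (↑u⁻¹ * b) * (↑u⁻¹ * b) = (0 : R) := by
    nth_rw 2 [hinv]
    rw [mul_assoc, ← mul_assoc b, hb, zero_mul, mul_zero]
  have h : 1 - z • (p + b) = u * (1 - z • (↑u⁻¹ * b)) := by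
    rw [mul_sub, mul_smul_comm, Units.mul_inv_cancel_left, mul_one, hu, smul_add]; abel
  rw [h]
  exact u.isUnit.mul (IsNilpotent.isUnit_one_sub ⟨2, by simp [pow_two, hsq]⟩)

end Banach

/-! ### Uniqueness of the generalized Drazin inverse, and an additive formula. -/

section Ring

variable {R : Type*} [Ring R] {a b : R}

theorem IsGDrazinInverse.commute (h : IsGDrazinInverse a b) : Commute a b := h.comm.symm

theorem IsGDrazinInverse.mul_mul_mul (h : IsGDrazinInverse a b) : a * b * (a * b) = a * b := by
  rw [mul_assoc, ← mul_assoc b, ← h.eq_mul]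

theorem IsGDrazinInverse.isIdempotentElem (h : IsGDrazinInverse a b) :
    IsIdempotentElem (a * b) := h.mul_mul_mul

theorem sub_sq_mul_eq (a b : R) : a - a ^ 2 * b = a * (1 - a * b) := by
  rw [mul_sub, mul_one, pow_two, mul_assoc]

theorem IsGDrazinInverse.mul_pow_eq (h : IsGDrazinInverse a b) (n : ℕ) :
    (a - a ^ 2 * b) ^ (n + 1) = a ^ (n + 1) * (1 - a * b) := by
  have hc : Commute a (1 - a * b) :=
    (Commute.one_right a).sub_right ((Commute.refl a).mul_right h.commute)
  rw [sub_sq_mul_eq, hc.mul_pow, h.isIdempotentElem.one_sub.pow_succ_eq]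

end Ring

section Banach

variable {R : Type*} [NormedRing R] [NormedAlgebra ℂ R] [CompleteSpace R]

/-- The defect equals `b' ^ (n + 1) * (a - a ^ 2 * b) ^ (n + 1)` for every `n`, and powers of a
quasinilpotent decay faster than any geometric sequence. -/
theorem IsGDrazinInverse.mul_eq_mul_mul_left {a b b' : R} (h : IsGDrazinInverse a b)
    (h' : IsGDrazinInverse a b') : a * b' = a * b' * (a * b) := by
  have hle : ∀ n : ℕ, ‖a * b' * (1 - a * b)‖ ≤
      ‖(a - a ^ 2 * b) ^ (n + 1)‖ * ‖b'‖ ^ (n + 1) := by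
    intro n
    have : a * b' * (1 - a * b) = b' ^ (n + 1) * (a - a ^ 2 * b) ^ (n + 1) := by
      rw [h.mul_pow_eq, ← mul_assoc, ← h'.commute.symm.mul_pow, h'.comm,
        h'.isIdempotentElem.pow_succ_eq]
    rw [this, mul_comm ‖_‖]
    refine (norm_mul_le _ _).trans ?_
    gcongr
    exact norm_pow_le' _ n.succ_pos
  have hz := ((summable_nat_add_iff 1).2
    (h.quasinilpotent.summable_norm_pow_mul ‖b'‖)).tendsto_atTop_zero
  have h0 : ‖a * b' * (1 - a * b)‖ ≤ 0 := ge_of_tendsto' hz hle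
  rw [norm_le_zero_iff, mul_sub, mul_one, sub_eq_zero] at h0
  exact h0

theorem IsGDrazinInverse.mul_eq_mul_mul_right {a b b' : R} (h : IsGDrazinInverse a b)
    (h' : IsGDrazinInverse a b') : a * b' = a * b * (a * b') := by
  have hle : ∀ n : ℕ, ‖(1 - a * b) * (a * b')‖ ≤
      ‖(a - a ^ 2 * b) ^ (n + 1)‖ * ‖b'‖ ^ (n + 1) := by
    intro n
    have hc : Commute (a ^ (n + 1)) (1 - a * b) :=
      ((Commute.one_right a).sub_right ((Commute.refl a).mul_right h.commute)).pow_left _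
    have : (1 - a * b) * (a * b') = (a - a ^ 2 * b) ^ (n + 1) * b' ^ (n + 1) := by
      rw [h.mul_pow_eq, hc.eq, mul_assoc, ← h'.commute.mul_pow,
        h'.isIdempotentElem.pow_succ_eq]
    rw [this]
    refine (norm_mul_le _ _).trans ?_
    gcongr
    exact norm_pow_le' _ n.succ_pos
  have hz := ((summable_nat_add_iff 1).2
    (h.quasinilpotent.summable_norm_pow_mul ‖b'‖)).tendsto_atTop_zero
  have h0 : ‖(1 - a * b) * (a * b')‖ ≤ 0 := ge_of_tendsto' hz hle
  rw [norm_le_zero_iff, sub_mul, one_mul, sub_eq_zero] at h0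
  exact h0

theorem IsGDrazinInverse.unique {a b b' : R} (h : IsGDrazinInverse a b)
    (h' : IsGDrazinInverse a b') : b = b' := by
  have hab : a * b = a * b' := (h'.mul_eq_mul_mul_left h).trans (h.mul_eq_mul_mul_right h').symm
  calc b = b * (a * b) := by rw [← mul_assoc, ← h.eq_mul]
    _ = b * a * b' := by rw [hab, mul_assoc]
    _ = b' * a * b' := by rw [h.comm, hab, h'.comm]
    _ = b' := h'.eq_mul.symm

theorem IsGDrazinInverse.gDrazinInv_eq {a b : R} (h : IsGDrazinInverse a b) :
    gDrazinInv a = b :=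
  (isGDrazinInverse_gDrazinInv ⟨b, h⟩).unique h

theorem IsGDrazinInverse.add_tsum {p q d : R} (h : IsGDrazinInverse p d) (hdq : d * q = 0)
    (hN : IsQuasinilpotent ((p + q) * (1 - p * d))) :
    Summable (fun n : ℕ => (p + q) ^ n * q * d ^ (n + 2)) ∧
      IsGDrazinInverse (p + q) (d + ∑' n : ℕ, (p + q) ^ n * q * d ^ (n + 2)) := by
  set m := p + q with hm
  set N := m * (1 - p * d) with hNdef
  have hpd : d * p = p * d := h.comm
  have hdpd : d * p * d = d := h.eq_mul.symm
  have hddp : d * d * p = d := by rw [mul_assoc, hpd, ← mul_assoc, hdpd]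
  have hdm : d * m = d * p := by rw [hm, mul_add, hdq, add_zero]
  have hpdm : p * d * m = p * d * p := by rw [mul_assoc, hdm, ← mul_assoc]
  have hdpow : ∀ n : ℕ, d * m ^ n * q = 0 := by
    intro n
    have : d * m ^ n = p ^ n * d := by
      induction n with
      | zero => simp
      | succ k ih => rw [pow_succ, ← mul_assoc, ih, mul_assoc, hdm, hpd, ← mul_assoc, ← pow_succ]
    rw [this, mul_assoc, hdq, mul_zero]
  have hpow : ∀ n : ℕ, m ^ n * q = N ^ n * q := by
    intro n
    induction n with
    | zero => simp
    | succ k ih =>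
      rw [pow_succ' N, mul_assoc, ← ih, hNdef, mul_assoc m, sub_mul, one_mul, mul_assoc p,
        ← mul_assoc d, hdpow, mul_zero, sub_zero, ← mul_assoc, ← pow_succ']
  have hsum : Summable (fun n : ℕ => m ^ n * q * d ^ (n + 2)) := by
    refine Summable.of_norm_bounded_eventually_nat
      ((hN.summable_norm_pow_mul ‖d‖).mul_right (‖q‖ * ‖d‖ ^ 2)) ?_
    filter_upwards with n
    rw [hpow]
    calc ‖N ^ n * q * d ^ (n + 2)‖ ≤ ‖N ^ n‖ * ‖q‖ * ‖d‖ ^ (n + 2) := by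
          refine (norm_mul_le _ _).trans ?_
          gcongr
          · exact norm_mul_le _ _
          · exact norm_pow_le' _ (by positivity)
      _ = ‖N ^ n‖ * ‖d‖ ^ n * (‖q‖ * ‖d‖ ^ 2) := by ring
  refine ⟨hsum, ?_⟩
  set s := ∑' n : ℕ, m ^ n * q * d ^ (n + 2) with hs
  have hds : d * s = 0 := by
    rw [hs, ← hsum.tsum_mul_left]
    simp [← mul_assoc, hdpow]
  have hsq : s * q = 0 := by
    rw [hs, ← hsum.tsum_mul_right]
    simp [pow_succ, mul_assoc, hdq]
  have hsdp : s * d * p = s := by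
    rw [mul_assoc, hs, ← hsum.tsum_mul_right]
    refine tsum_congr fun n => ?_
    have hd : d * (d * p) = d := by rw [← mul_assoc, hddp]
    simp only [pow_succ, mul_assoc, hd]
  -- Split off the term `n = 0` and shift the index.
  have hrec : s = q * d ^ 2 + m * s * d := by
    have hshift := hsum.tsum_eq_zero_add
    rw [← hs] at hshift
    refine hshift.trans ?_
    rw [hs, ← hsum.tsum_mul_left, ← (hsum.mul_left m).tsum_mul_right]
    congr 1
    · simp
    · exact tsum_congr fun n => by rw [pow_succ' m, pow_succ d (n + 2)]; simp only [mul_assoc,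
        pow_succ]
  have hsp : s * p = q * d + m * s := by
    calc s * p = q * (d * d * p) + m * (s * d * p) := by
          nth_rw 1 [hrec]
          rw [add_mul, pow_two]; simp only [mul_assoc]
      _ = _ := by rw [hddp, hsdp]
  have hxm : (d + s) * m = d * p + s * p := by
    rw [add_mul, hdm, hm, mul_add s, hsq, add_zero]
  have hmx : m * (d + s) = d * p + s * p := by
    rw [mul_add, hsp, hpd]
    nth_rw 1 [hm]
    rw [add_mul, add_assoc]
  have hsps : s * p * s = 0 := by
    calc s * p * s = s * d * p * p * s := by rw [hsdp]
      _ = s * (d * p) * p * s := by simp only [mul_assoc]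
      _ = s * p * (d * p) * s := by rw [hpd]; simp only [mul_assoc, hpd]
      _ = s * p * p * (d * s) := by rw [hpd]; simp only [mul_assoc]
      _ = 0 := by rw [hds, mul_zero]
  have hspd : s * p * d = s := by rw [mul_assoc, ← hpd, ← mul_assoc, hsdp]
  have hwe : m * (s * p) * (d * p) = m * (s * p) := by
    rw [mul_assoc, ← mul_assoc (s * p), hspd]
  have hes : d * p * m * (s * p) = 0 := by
    rw [hpd, hpdm, mul_assoc p, hpd]
    simp only [mul_assoc]
    rw [← mul_assoc d s, hds]
    simp
  have heN : d * p * N = 0 := by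
    have hp : p * d * p * (p * d) = p * d * p := by
      rw [mul_assoc p d p, hpd, mul_assoc, h.mul_mul_mul]
    rw [hNdef, ← mul_assoc, hpd, hpdm, mul_sub, mul_one, hp, sub_self]
  refine ⟨hxm.trans hmx.symm, ?_, ?_⟩
  · rw [hxm, add_mul, mul_add, mul_add, hdpd, hsps, hspd, hpd, mul_assoc p, hds]
    simp
  · have : m - m ^ 2 * (d + s) = N + -(m * (s * p)) := by
      rw [pow_two, mul_assoc, hmx, hNdef, mul_sub, mul_add, mul_one, hpd]; abel
    rw [this]
    -- Both conditions hold since `m * (s * p)` absorbs `d * p` on its right, while `d * p` kills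
    -- `N` and `m * (s * p)` from the left.
    refine hN.add_of_mul_eq_zero' ?_ ?_
    · rw [neg_mul_neg]
      nth_rw 1 [← hwe]
      rw [mul_assoc, ← mul_assoc (d * p), hes, mul_zero]
    · rw [neg_mul, ← hwe, mul_assoc, heN, mul_zero, neg_zero]

theorem IsGDrazinInverse.isQuasinilpotent_add_add_mul {p b c d : R} {k : ℂ}
    (h : IsGDrazinInverse p d) (hdb : d * b = 0) (hpb : p * b = k • (b * p))
    (hpc : p * c = 0) (hbb : b * b = 0) (hbc : b * c = 0) (hcc : c * c = 0) :
    IsQuasinilpotent ((p + (b + c)) * (1 - p * d)) := by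
  set u := 1 - p * d with hu
  have hdc : d * c = 0 := by
    rw [h.eq_mul, mul_assoc d p d, ← h.comm, ← mul_assoc, mul_assoc, hpc, mul_zero]
  have hub : u * b = b := by rw [hu, sub_mul, mul_assoc, hdb, mul_zero, sub_zero, one_mul]
  have huc : u * c = c := by rw [hu, sub_mul, mul_assoc, hdc, mul_zero, sub_zero, one_mul]
  have huu : u * u = u := h.isIdempotentElem.one_sub
  have hpu : p * u = u * p :=
    ((Commute.one_right p).sub_right ((Commute.refl p).mul_right h.commute)).eq
  have hubx : ∀ x, u * (b * x) = b * x := fun x => by rw [← mul_assoc, hub]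
  have hucx : ∀ x, u * (c * x) = c * x := fun x => by rw [← mul_assoc, huc]
  have hq : IsQuasinilpotent (p * u) := by
    rw [← sub_sq_mul_eq]; exact h.quasinilpotent
  have hsplit : (p + (b + c)) * u = p * u + b * u + c * u := by
    rw [add_mul, add_mul, add_assoc]
  rw [hsplit]
  refine (hq.add_of_mul_eq_smul (c := k) ?_ ?_).add_of_mul_eq_zero ?_ ?_
  · rw [mul_assoc, hubx, ← mul_assoc, hbb, zero_mul]
  · rw [mul_assoc p, hubx, ← mul_assoc, hpb, smul_mul_assoc, hpu, mul_assoc b u,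
      ← mul_assoc u u, huu, mul_assoc b, hpu]
  · rw [mul_assoc, hucx, ← mul_assoc, hcc, zero_mul]
  · rw [add_mul, mul_assoc, hucx, mul_assoc b, hucx, ← mul_assoc, ← mul_assoc, hpc, hbc]
    simp

end Banach

end GDrazin

namespace GDrazin

/-! ### Application to 2×2 matrices. -/

section Matrix

attribute [local instance] Matrix.linftyOpNormedRing Matrix.linftyOpNormedAlgebra

/-- The uniformity of this auxiliary norm is the entrywise one, so convergence in it is the
convergence claimed. -/
theorem completeSpace_matrix_linftyOp {𝒜 : Type*} [NormedRing 𝒜] [CompleteSpace 𝒜] :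
     @CompleteSpace (Matrix (Fin 2) (Fin 2) 𝒜)
    (Matrix.linftyOpNormedRing : NormedRing (Matrix (Fin 2) (Fin 2) 𝒜)).toUniformSpace :=
  inferInstanceAs (CompleteSpace (Fin 2 → Fin 2 → 𝒜))

variable {𝒜 : Type*} [NormedRing 𝒜] [NormedAlgebra ℂ 𝒜] [CompleteSpace 𝒜]

attribute [local instance] completeSpace_matrix_linftyOp

theorem IsQuasinilpotent.fin_two_diagonal {a d : 𝒜} (ha : IsQuasinilpotent a)
    (hd : IsQuasinilpotent d) : IsQuasinilpotent !![a, 0; 0, d] := by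
  refine isQuasinilpotent_of_isUnit_one_sub_smul fun z => ?_
  obtain ⟨u, hu⟩ := ha.isUnit_one_sub_smul z
  obtain ⟨v, hv⟩ := hd.isUnit_one_sub_smul z
  have h : 1 - z • !![a, 0; 0, d] = !![(u : 𝒜), 0; 0, (v : 𝒜)] := by
    rw [hu, hv]
    ext i j
    fin_cases i <;> fin_cases j <;> simp
  rw [h]
  exact ⟨⟨!![(u : 𝒜), 0; 0, (v : 𝒜)], !![(↑u⁻¹ : 𝒜), 0; 0, (↑v⁻¹ : 𝒜)],
    by simp [Matrix.one_fin_two], by simp [Matrix.one_fin_two]⟩, rfl⟩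

theorem IsGDrazinInverse.fin_two_diagonal {a d a' d' : 𝒜} (ha : IsGDrazinInverse a a')
    (hd : IsGDrazinInverse d d') : IsGDrazinInverse !![a, 0; 0, d] !![a', 0; 0, d'] where
  comm := by simp [ha.comm, hd.comm]
  eq_mul := by simp [← ha.eq_mul, ← hd.eq_mul]
  quasinilpotent := by
    have h : !![a, 0; 0, d] - !![a, 0; 0, d] ^ 2 * !![a', 0; 0, d'] =
        !![a - a ^ 2 * a', 0; 0, d - d ^ 2 * d'] := by
      ext i j
      fin_cases i <;> fin_cases j <;> simp [pow_two]
    rw [h]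
    exact ha.quasinilpotent.fin_two_diagonal hd.quasinilpotent

theorem IsGDrazinInverse.mul_eq_zero_of_mul_eq_smul {R : Type*} [Ring R] [Algebra ℂ R]
    {a b x y : R} {k : ℂ} (h : IsGDrazinInverse a b)
    (hx : a * x = k • ((1 - a * b) * x * y)) : b * x = 0 := by
  have h0 : b * (1 - a * b) = 0 := by rw [mul_sub, mul_one, ← mul_assoc, ← h.eq_mul, sub_self]
  have h1 : b * (a * x) = 0 := by
    rw [hx, mul_smul_comm, ← mul_assoc, ← mul_assoc, h0, zero_mul, zero_mul, smul_zero]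
  rw [h.eq_mul, mul_assoc b a b, ← h.comm, mul_assoc, mul_assoc, h1, mul_zero]

theorem gDrazinInv_fin_two_of_mul_eq_smul (A B C D : 𝒜) (c : ℂ)
    (hA : IsGDrazinInvertible A) (hD : IsGDrazinInvertible D)
    (hAB : A * B = c • (spectralIdempotent A * B * D))
    (hDC : D * C = 0) (hBC : B * C = 0)
    (M P Q : Matrix (Fin 2) (Fin 2) 𝒜)
    (hM : M = !![A, B; C, D]) (hP : P = !![A, 0; 0, D]) (hQ : Q = !![0, B; C, 0]) :
    IsGDrazinInvertible P ∧
    IsGDrazinInvertible M ∧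
    Summable (fun n : ℕ => M ^ n * Q * gDrazinInv P ^ (n + 2)) ∧
    gDrazinInv M =
      !![gDrazinInv A, 0; 0, gDrazinInv D] +
        ∑' n : ℕ, M ^ n * Q * gDrazinInv P ^ (n + 2) := by
  subst hM hP hQ
  have hA' := isGDrazinInverse_gDrazinInv hA
  have hD' := isGDrazinInverse_gDrazinInv hD
  have hP' := hA'.fin_two_diagonal hD'
  have hdB : gDrazinInv A * B = 0 := hA'.mul_eq_zero_of_mul_eq_smul hAB
  have hdC : gDrazinInv D * C = 0 :=
    hD'.mul_eq_zero_of_mul_eq_smul (k := 0) (y := 0) (by simp [hDC])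
  -- The spectral idempotent fixes `B`, because `gDrazinInv A * B = 0`.
  have hAB' : A * B = c • (B * D) := by
    rw [hAB, spectralIdempotent, sub_mul, one_mul, mul_assoc A, hdB, mul_zero, sub_zero]
  have hM : !![A, B; C, D] = !![A, 0; 0, D] + !![0, B; C, 0] := by simp
  have hQ : !![0, B; C, 0] = !![0, B; 0, 0] + !![0, 0; C, 0] := by simp
  have hN : IsQuasinilpotent ((!![A, 0; 0, D] + !![0, B; C, 0]) *
      (1 - !![A, 0; 0, D] * !![gDrazinInv A, 0; 0, gDrazinInv D])) := by
    rw [hQ]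
    refine hP'.isQuasinilpotent_add_add_mul (k := c) ?_ ?_ ?_ ?_ ?_ ?_ <;>
      ext i j <;> fin_cases i <;> fin_cases j <;> simp [hdB, hAB', hDC, hBC]
  obtain ⟨hsum, hinv⟩ := hP'.add_tsum (q := !![0, B; C, 0]) (by
    ext i j; fin_cases i <;> fin_cases j <;> simp [hdB, hdC]) hN
  rw [hP'.gDrazinInv_eq, hM]
  exact ⟨⟨_, hP'⟩, ⟨_, hinv⟩, hsum, hinv.gDrazinInv_eq⟩

end Matrix

end GDrazin

theorem corollary3p4 {𝒜 : Type*} [NormedRing 𝒜] [NormedAlgebra ℂ 𝒜] [CompleteSpace 𝒜]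
    (A B C D : 𝒜) (c : ℂ) (hc : c ≠ 0)
    (hA : GDrazin.IsGDrazinInvertible A) (hD : GDrazin.IsGDrazinInvertible D)
    (hAB : A * B = c • (GDrazin.spectralIdempotent A * B * D))
    (hDC : D * C = 0) (hBC : B * C = 0)
    (M P Q : Matrix (Fin 2) (Fin 2) 𝒜)
    (hM : M = !![A, B; C, D]) (hP : P = !![A, 0; 0, D]) (hQ : Q = !![0, B; C, 0]) :
    GDrazin.IsGDrazinInvertible P ∧
    GDrazin.IsGDrazinInvertible M ∧
    Summable (fun n : ℕ => M ^ n * Q * GDrazin.gDrazinInv P ^ (n + 2)) ∧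
    GDrazin.gDrazinInv M =
      !![GDrazin.gDrazinInv A, 0; 0, GDrazin.gDrazinInv D] +
        ∑' n : ℕ, M ^ n * Q * GDrazin.gDrazinInv P ^ (n + 2) :=
  GDrazin.gDrazinInv_fin_two_of_mul_eq_smul A B C D c hA hD hAB hDC hBC M P Q hM hP hQ
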